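/- Let $\mathcal P(\mathbb R^2)$ be the set of Borel probability measures on $\mathbb R^2$, with the topology of weak convergence. For $0<d<2$ and $0\le t\le 1$ define an operator $\mathrm{LL}^\otimes_{d,t}:\mathcal P(\mathbb R^2)\to\mathcal P(\mathbb R^2)$ as follows. Given $\rho\in\mathcal P(\mathbb R^2)$, let $\xi_i=(\xi_{i,1},\xi_{i,2})$, $\xi'_i=(\xi'_{i,1},\xi'_{i,2})$, $\xi''_i=(\xi''_{i,1},\xi''_{i,2})$ $(i\ge1)$ be random vectors with distribution $\rho$, let $D\sim\mathrm{Po}(td)$ and $D',D''\sim\mathrm{Po}((1-t)d)$ be Poisson variables, and let $s_i,s'_i,s''_i,r_i,r'_i,r''_i$ $(i\ge1)$ be uniformly random on $\{1,-1\}$, all mutually independent. Then $\mathrm{LL}^\otimes_{d,t}(\rho)$ is the distribution of the vector $$\begin{pmatrix}\sum_{i=1}^{D}s_i\log\left(\tfrac12\left(1+r_i\tanh(\xi_{i,1}/2)\right)\right)+\sum_{i=1}^{D'}s'_i\log\left(\tfrac12\left(1+r'_i\tanh(\xi'_{i,1}/2)\right)\right)\\[1ex]\sum_{i=1}^{D}s_i\log\left(\tfrac12\left(1+r_i\tanh(\xi_{i,2}/2)\right)\right)+\sum_{i=1}^{D''}s''_i\log\left(\tfrac12\left(1+r''_i\tanh(\xi''_{i,2}/2)\right)\right)\end{pmatrix}.$$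 Let $\mathcal W_2(\mathbb R^2)$ be the set of $\rho\in\mathcal P(\mathbb R^2)$ with $\int\|\xi\|_2^2\,\mathrm d\rho(\xi)<\infty$, and let $W_2(\rho,\nu)=\inf\mathbb E[\|X-Y\|_2^2]^{1/2}$, where the infimum is over all pairs of random vectors $X,Y$ on a common probability space such that $X$ has distribution $\rho$ and $Y$ has distribution $\nu$. **Proposition.** Let $0<d<2$ and $0\le t\le1$. 1. There exists a unique $\rho_{d,t}\in\mathcal W_2(\mathbb R^2)$ such that $\mathrm{LL}^\otimes_{d,t}(\rho_{d,t})=\rho_{d,t}$. Moreover, if $\rho^{(0)}_{d,t}$ is the atom at the origin and $\rho^{(\ell)}_{d,t}=\mathrm{LL}^\otimes_{d,t}(\rho^{(\ell-1)}_{d,t})$ for $\ell\ge1$, then $\rho^{(\ell)}_{d,t}\to\rho_{d,t}$ weakly as $\ell\to\infty$. 2. The operator $\mathrm{LL}^\otimes_{d,t}$ maps $\mathcal W_2(\mathbb R^2)$ into itself and is a contraction for $W_2$ with Lipschitz constant $\sqrt{d/2}<1$: for all $\rho,\nu\in\mathcal W_2(\mathbb R^2)$, $$W_2\left(\mathrm{LL}^\otimes_{d,t}(\rho),\mathrm{LL}^\otimes_{d,t}(\nu)\right)\le\sqrt{d/2}\;W_2(\rho,\nu).$$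 -/

import Mathlib

open MeasureTheory ProbabilityTheory Filter Topology

noncomputable section

namespace TwoSAT

/-- The plane with its Euclidean norm. -/
abbrev Plane : Type := EuclideanSpace ℝ (Fin 2)

/-- The uniform distribution on the two signs `1` and `-1`. -/
def signMeasure : Measure ℝ :=
  (2⁻¹ : ENNReal) • Measure.dirac 1 + (2⁻¹ : ENNReal) • Measure.dirac (-1)

instance : IsProbabilityMeasure signMeasure :=
  ⟨by simp [signMeasure, ENNReal.inv_two_add_inv_two]⟩

/-- The data `(ξ, s, r)` attached to one summand: a vector and two signs. -/
abbrev Mark : Type := Plane × ℝ × ℝ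

/-- The law of one mark: `ξ` has law `ρ`, the signs `s`, `r` are uniform, all independent. -/
def markMeasure (ρ : ProbabilityMeasure Plane) : Measure Mark :=
  (ρ : Measure Plane).prod (signMeasure.prod signMeasure)

instance (ρ : ProbabilityMeasure Plane) : IsProbabilityMeasure (markMeasure ρ) := by
  unfold markMeasure; infer_instance

/-- A number of summands together with an infinite sequence of marks. -/
abbrev Block : Type := ℕ × (ℕ → Mark)

/-- The law of a block: a Poisson variable with mean `lam` and, independently of it,
a sequence of independent marks. -/
def blockMeasure (lam : ℝ) (ρ : ProbabilityMeasure Plane) : Measure Block :=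
  (poissonMeasure lam.toNNReal).prod (Measure.infinitePi fun _ : ℕ => markMeasure ρ)

instance (lam : ℝ) (ρ : ProbabilityMeasure Plane) :
    IsProbabilityMeasure (blockMeasure lam ρ) := by
  unfold blockMeasure; infer_instance

/-- The sum `∑ i, s_i * log ((1 + r_i * tanh (ξ_{i,h} / 2)) / 2)` over the first `b.1` marks of
a block, for the coordinate `h` of the vectors. -/
def blockSum (h : Fin 2) (b : Block) : ℝ :=
  ∑ i ∈ Finset.range b.1,
    (b.2 i).2.1 * Real.log (1 / 2 * (1 + (b.2 i).2.2 * Real.tanh ((b.2 i).1 h / 2)))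

theorem measurable_blockSum (h : Fin 2) : Measurable (blockSum h) := by
  have htanh : Measurable Real.tanh := by
    have : Real.tanh = fun x => Real.sinh x / Real.cosh x := by
      funext x; exact Real.tanh_eq_sinh_div_cosh x
    rw [this]
    exact Real.measurable_sinh.div Real.measurable_cosh
  refine measurable_from_prod_countable_right fun n => ?_
  change Measurable fun x : ℕ → Mark => ∑ i ∈ Finset.range n,
    (x i).2.1 * Real.log (1 / 2 * (1 + (x i).2.2 * Real.tanh ((x i).1 h / 2)))
  refine Finset.measurable_sum _ fun i _ => ?_
  have hm : Measurable fun x : ℕ → Mark => x i := measurable_pi_apply i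
  have hc : Measurable fun x : ℕ → Mark => (x i).1 h :=
    (EuclideanSpace.proj (𝕜 := ℝ) h).continuous.measurable.comp hm.fst
  exact hm.snd.fst.mul (Real.measurable_log.comp
    (((hm.snd.snd.mul (htanh.comp (hc.div_const 2))).const_add 1).const_mul (1 / 2)))

/-- The random vector defining the operator. The first block (`ξ_i, s_i, r_i`) contributes to both
coordinates, the second one (`ξ'_i, s'_i, r'_i`) only to the first coordinate, and the third one
(`ξ''_i, s''_i, r''_i`) only to the second coordinate. -/
def updateVector (ω : Block × Block × Block) : Plane :=
  !₂[blockSum 0 ω.1 + blockSum 0 ω.2.1, blockSum 1 ω.1 + blockSum 1 ω.2.2]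

theorem measurable_updateVector : Measurable updateVector := by
  refine (WithLp.measurable_toLp 2 (Fin 2 → ℝ)).comp (measurable_pi_lambda _ fun j => ?_)
  fin_cases j
  · exact ((measurable_blockSum 0).comp measurable_fst).add
      ((measurable_blockSum 0).comp measurable_snd.fst)
  · exact ((measurable_blockSum 1).comp measurable_fst).add
      ((measurable_blockSum 1).comp measurable_snd.snd)

/-- The joint law of three independent blocks, of Poisson means `t d`, `(1 - t) d`
and `(1 - t) d`. -/
def updateSource (d t : ℝ) (ρ : ProbabilityMeasure Plane) :
    ProbabilityMeasure (Block × Block × Block) :=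
  ⟨(blockMeasure (t * d) ρ).prod
    ((blockMeasure ((1 - t) * d) ρ).prod (blockMeasure ((1 - t) * d) ρ)), inferInstance⟩

/-- The log-Belief-Propagation operator on the Borel probability measures on the plane. -/
def logBP (d t : ℝ) (ρ : ProbabilityMeasure Plane) : ProbabilityMeasure Plane :=
  (updateSource d t ρ).map measurable_updateVector.aemeasurable

/-- The atom at the origin. -/
def atomZero : ProbabilityMeasure Plane := ⟨Measure.dirac 0, inferInstance⟩

/-- `∫ ‖ξ‖² dρ(ξ) < ∞`. -/
def FiniteSecondMoment (ρ : ProbabilityMeasure Plane) : Prop :=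
  ∫⁻ x, ‖x‖ₑ ^ 2 ∂(ρ : Measure Plane) < ⊤

/-- The joint laws of pairs `(X, Y)` such that `X` has law `ρ` and `Y` has law `ν`. -/
def couplings (ρ ν : ProbabilityMeasure Plane) : Set (Measure (Plane × Plane)) :=
  {γ | γ.map Prod.fst = (ρ : Measure Plane) ∧ γ.map Prod.snd = (ν : Measure Plane)}

/-- The Wasserstein distance of order two (finite if both laws have finite second moment). -/
def wasserstein2 (ρ ν : ProbabilityMeasure Plane) : ENNReal :=
  ⨅ γ ∈ couplings ρ ν, (∫⁻ p, ‖p.1 - p.2‖ₑ ^ 2 ∂γ) ^ (1 / 2 : ℝ)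

end TwoSAT

end

/-! Contraction comes from coupling. Given a coupling of the two input laws, run both updates with
the same Poisson numbers and signs. The coordinates of the difference are then compound Poisson sums
of terms centred by the sign `s`, so their second moment is the Poisson mean times the second moment
of one term. Both coordinates have total mean `d`, whatever `t` is. Averaging over `r` leaves half
of the left side of `logTanh_sq_sub_le`, whence the factor `d / 2`: the two log terms move in
opposite directions as `x` varies, and their difference is exactly `x`.

Existence avoids completeness of the Wasserstein space. Characteristic functions are Lipschitz in
the Wasserstein distance (`enorm_charFun_sub_le`), so along the iteration they are Cauchy at every
point. A uniform second moment bound (`exists_lintegral_iterate_le`) gives tightness, hence a weak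
limit. The operator is weakly sequentially continuous because its characteristic function is
explicit (`charFun_logBP`), so the limit is a fixed point; its second moment is finite by lower
semicontinuity. Uniqueness follows from the contraction, as distance zero forces equal
characteristic functions. -/

open MeasureTheory ProbabilityTheory Filter Topology

noncomputable section

namespace TwoSAT

/-! ### Second moments of independent sums -/

section SecondMoments

variable {Ω Ω' : Type*} [MeasurableSpace Ω] [MeasurableSpace Ω']

theorem memLp_two_iff_lintegral {P : Measure Ω} {X : Ω → ℝ} (hX : Measurable X) :
    MemLp X 2 P ↔ ∫⁻ ω, ‖X ω‖ₑ ^ 2 ∂P < ⊤ := by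
  rw [memLp_two_iff_integrable_sq hX.aestronglyMeasurable, Integrable,
    and_iff_right (hX.pow_const 2).aestronglyMeasurable, HasFiniteIntegral]
  simp only [enorm_pow]

theorem lintegral_enorm_sq_eq_ofReal {P : Measure Ω} {X : Ω → ℝ} (hX : MemLp X 2 P) :
    ∫⁻ ω, ‖X ω‖ₑ ^ 2 ∂P = ENNReal.ofReal (∫ ω, X ω ^ 2 ∂P) := by
  rw [ofReal_integral_eq_lintegral_ofReal hX.integrable_sq
    (Eventually.of_forall fun ω => sq_nonneg _)]
  refine lintegral_congr fun ω => ?_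
  rw [← enorm_pow, Real.enorm_eq_ofReal (sq_nonneg _)]

/-- Second moments of independent variables add up, if one of them is centred. -/
theorem lintegral_enorm_sq_add_prod {P : Measure Ω} {Q : Measure Ω'} [IsProbabilityMeasure P]
    [IsProbabilityMeasure Q] {X : Ω → ℝ} {Y : Ω' → ℝ} (hX : MemLp X 2 P) (hY : MemLp Y 2 Q)
    (hX0 : ∫ ω, X ω ∂P = 0) :
    ∫⁻ ω, ‖X ω.1 + Y ω.2‖ₑ ^ 2 ∂(P.prod Q) =
      ∫⁻ ω, ‖X ω‖ₑ ^ 2 ∂P + ∫⁻ ω, ‖Y ω‖ₑ ^ 2 ∂Q := by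
  have hX' : MemLp (fun ω : Ω × Ω' => X ω.1) 2 (P.prod Q) :=
    hX.comp_measurePreserving measurePreserving_fst
  have hY' : MemLp (fun ω : Ω × Ω' => Y ω.2) 2 (P.prod Q) :=
    hY.comp_measurePreserving measurePreserving_snd
  have hsum := lintegral_enorm_sq_eq_ofReal (hX'.add hY')
  simp only [Pi.add_apply] at hsum
  rw [hsum, lintegral_enorm_sq_eq_ofReal hX,
    lintegral_enorm_sq_eq_ofReal hY, ← ENNReal.ofReal_add
    (integral_nonneg fun _ => sq_nonneg _) (integral_nonneg fun _ => sq_nonneg _)]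
  congr 1
  have hcross : Integrable (fun ω : Ω × Ω' => 2 * (X ω.1 * Y ω.2)) (P.prod Q) :=
    (hX'.integrable_mul hY').const_mul 2
  have hleft : Integrable (fun ω : Ω × Ω' => X ω.1 ^ 2 + 2 * (X ω.1 * Y ω.2)) (P.prod Q) :=
    hX'.integrable_sq.add hcross
  calc ∫ ω : Ω × Ω', (X ω.1 + Y ω.2) ^ 2 ∂(P.prod Q)
      = ∫ ω : Ω × Ω', (X ω.1 ^ 2 + 2 * (X ω.1 * Y ω.2)) + Y ω.2 ^ 2 ∂(P.prod Q) := by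
        refine integral_congr_ae (Eventually.of_forall fun ω => ?_)
        simp only
        ring
    _ = ∫ ω, X ω ^ 2 ∂P + ∫ ω, Y ω ^ 2 ∂Q := by
        rw [integral_add hleft hY'.integrable_sq,
          integral_add hX'.integrable_sq hcross, integral_const_mul, integral_prod_mul, hX0,
          integral_fun_fst (fun ω => X ω ^ 2), integral_fun_snd (fun ω => Y ω ^ 2)]
        simp

end SecondMoments

theorem lintegral_natCast_poissonMeasure (r : NNReal) :
    ∫⁻ n, (n : ENNReal) ∂(poissonMeasure r) = r := by
  -- Size biasing: `(n + 1)` times the Poisson weight at `n + 1` is `r` times the weight at `n`.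
  have hterm (n : ℕ) : ENNReal.ofReal (Real.exp (-r) * r ^ (n + 1) / (n + 1).factorial) *
      ((n + 1 : ℕ) : ENNReal) = r * ENNReal.ofReal (Real.exp (-r) * r ^ n / n.factorial) := by
    rw [← ENNReal.ofReal_natCast, ← ENNReal.ofReal_coe_nnreal,
      ← ENNReal.ofReal_mul (by positivity), ← ENNReal.ofReal_mul (by positivity)]
    congr 1
    rw [Nat.factorial_succ]
    push_cast
    field_simp
    ring
  rw [poissonMeasure, lintegral_sum_measure]
  simp only [lintegral_smul_measure, lintegral_dirac, smul_eq_mul]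
  rw [tsum_eq_zero_add' ENNReal.summable]
  simp only [hterm, ENNReal.tsum_mul_left]
  rw [← ENNReal.ofReal_tsum_of_nonneg (fun n => by positivity)
    (hasSum_one_poissonMeasure r).summable, (hasSum_one_poissonMeasure r).tsum_eq]
  simp

/-! ### Compound Poisson sums -/

section CompoundSums

variable {α β : Type*} [MeasurableSpace α] [MeasurableSpace β]

/-- The law of a Poisson number together with an independent sequence of independent marks of
law `μ`. -/
def compoundMeasure (lam : ℝ) (μ : Measure α) : Measure (ℕ × (ℕ → α)) :=
  (poissonMeasure lam.toNNReal).prod (Measure.infinitePi fun _ : ℕ => μ)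

instance (lam : ℝ) (μ : Measure α) [IsProbabilityMeasure μ] :
    IsProbabilityMeasure (compoundMeasure lam μ) := by
  unfold compoundMeasure; infer_instance

/-- The sum of `g` over a random number of marks. -/
def compoundSum (g : α → ℝ) (b : ℕ × (ℕ → α)) : ℝ :=
  ∑ i ∈ Finset.range b.1, g (b.2 i)

theorem measurable_compoundSum {g : α → ℝ} (hg : Measurable g) : Measurable (compoundSum g) := by
  refine measurable_from_prod_countable_right fun n => ?_
  change Measurable fun x : ℕ → α => ∑ i ∈ Finset.range n, g (x i)
  fun_prop

variable {μ : Measure α} [IsProbabilityMeasure μ] {g : α → ℝ}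

theorem memLp_eval_infinitePi (hg : MemLp g 2 μ) (i : ℕ) :
    MemLp (fun x : ℕ → α => g (x i)) 2 (Measure.infinitePi fun _ : ℕ => μ) :=
  hg.comp_measurePreserving (measurePreserving_eval_infinitePi (fun _ : ℕ => μ) i)

theorem integral_eval_infinitePi {E : Type*} [NormedAddCommGroup E] [NormedSpace ℝ E]
    {f : α → E} (hf : AEStronglyMeasurable f μ) (i : ℕ) :
    ∫ x, f (x i) ∂(Measure.infinitePi fun _ : ℕ => μ) = ∫ a, f a ∂μ := by
  have h := (measurePreserving_eval_infinitePi (fun _ : ℕ => μ) i)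
  have hmap := h.map_eq
  have := integral_map (μ := Measure.infinitePi fun _ : ℕ => μ) (φ := Function.eval i) (f := f)
    h.measurable.aemeasurable (by rw [hmap]; exact hf)
  rw [hmap] at this
  exact this.symm

theorem integral_sum_infinitePi (hg : MemLp g 2 μ) (hg0 : ∫ a, g a ∂μ = 0) (n : ℕ) :
    ∫ x, ∑ i ∈ Finset.range n, g (x i) ∂(Measure.infinitePi fun _ : ℕ => μ) = 0 := by
  rw [integral_finsetSum _ fun i _ => (memLp_eval_infinitePi hg i).integrable one_le_two]
  simp [integral_eval_infinitePi hg.aestronglyMeasurable, hg0]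

/-- Variances of independent terms add, and centring identifies variances with second moments. -/
theorem lintegral_enorm_sq_sum_infinitePi (hgm : Measurable g) (hg : MemLp g 2 μ)
    (hg0 : ∫ a, g a ∂μ = 0) (n : ℕ) :
    ∫⁻ x, ‖∑ i ∈ Finset.range n, g (x i)‖ₑ ^ 2 ∂(Measure.infinitePi fun _ : ℕ => μ) =
      n * ∫⁻ a, ‖g a‖ₑ ^ 2 ∂μ := by
  have hmem := memLp_eval_infinitePi hg
  have hind : iIndepFun (fun (i : ℕ) (x : ℕ → α) => g (x i)) (Measure.infinitePi fun _ => μ) :=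
    iIndepFun_infinitePi (fun _ => hgm)
  have hsum : MemLp (∑ i ∈ Finset.range n, fun x : ℕ → α => g (x i)) 2
      (Measure.infinitePi fun _ : ℕ => μ) := memLp_finsetSum' _ fun i _ => hmem i
  have hvar := IndepFun.variance_sum (s := Finset.range n) (fun i _ => hmem i)
    fun i _ j _ hij => hind.indepFun hij
  have hfun : (fun x : ℕ → α => ∑ i ∈ Finset.range n, g (x i)) =
      ∑ i ∈ Finset.range n, fun x : ℕ → α => g (x i) := by
    ext x; simp
  have hmean := integral_sum_infinitePi hg hg0 n
  rw [hfun] at hmean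
  rw [variance_of_integral_eq_zero hsum.aemeasurable hmean] at hvar
  have hone (i : ℕ) : Var[fun x : ℕ → α => g (x i); Measure.infinitePi fun _ => μ] =
      ∫ a, g a ^ 2 ∂μ := by
    rw [variance_of_integral_eq_zero (hmem i).aemeasurable
      ((integral_eval_infinitePi hg.aestronglyMeasurable i).trans hg0)]
    exact integral_eval_infinitePi (hg.aestronglyMeasurable.pow 2) i
  simp only [hone, Finset.sum_const, Finset.card_range, nsmul_eq_mul] at hvar
  have := lintegral_enorm_sq_eq_ofReal hsum
  rw [hvar, ENNReal.ofReal_mul (by positivity), ENNReal.ofReal_natCast,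
    ← lintegral_enorm_sq_eq_ofReal hg, ← hfun] at this
  exact this

/-- Conditionally on the number of terms the second moment is linear in it, thanks to centring;
hence only the mean of the Poisson variable enters. -/
theorem lintegral_enorm_sq_compoundSum (lam : ℝ) (hgm : Measurable g) (hg : MemLp g 2 μ)
    (hg0 : ∫ a, g a ∂μ = 0) :
    ∫⁻ b, ‖compoundSum g b‖ₑ ^ 2 ∂(compoundMeasure lam μ) =
      ENNReal.ofReal lam * ∫⁻ a, ‖g a‖ₑ ^ 2 ∂μ := by
  rw [compoundMeasure, lintegral_prod _
    ((measurable_compoundSum hgm).enorm.pow_const 2).aemeasurable]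
  simp only [compoundSum, lintegral_enorm_sq_sum_infinitePi hgm hg hg0]
  rw [lintegral_mul_const _ .of_discrete, lintegral_natCast_poissonMeasure, ENNReal.ofReal]

theorem memLp_compoundSum (lam : ℝ) (hgm : Measurable g) (hg : MemLp g 2 μ)
    (hg0 : ∫ a, g a ∂μ = 0) : MemLp (compoundSum g) 2 (compoundMeasure lam μ) := by
  rw [memLp_two_iff_lintegral (measurable_compoundSum hgm),
    lintegral_enorm_sq_compoundSum lam hgm hg hg0]
  exact ENNReal.mul_lt_top ENNReal.ofReal_lt_top ((memLp_two_iff_lintegral hgm).1 hg)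

theorem integral_compoundSum (lam : ℝ) (hgm : Measurable g) (hg : MemLp g 2 μ)
    (hg0 : ∫ a, g a ∂μ = 0) : ∫ b, compoundSum g b ∂(compoundMeasure lam μ) = 0 := by
  have := (memLp_compoundSum lam hgm hg hg0).integrable one_le_two
  rw [compoundMeasure] at this ⊢
  rw [integral_prod _ this]
  simp [compoundSum, integral_sum_infinitePi hg hg0]

/-- The law of three independent compound blocks of means `t d`, `(1 - t) d`, `(1 - t) d`. -/
def sourceMeasure (d t : ℝ) (μ : Measure α) :
    Measure ((ℕ × (ℕ → α)) × (ℕ × (ℕ → α)) × (ℕ × (ℕ → α))) :=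
  (compoundMeasure (t * d) μ).prod
    ((compoundMeasure ((1 - t) * d) μ).prod (compoundMeasure ((1 - t) * d) μ))

/-- The vector with the coordinates `∑ g 0 + ∑' g 0` and `∑ g 1 + ∑'' g 1`, where the sums extend
over three blocks. -/
def compoundVector (g : Fin 2 → α → ℝ)
    (ω : (ℕ × (ℕ → α)) × (ℕ × (ℕ → α)) × (ℕ × (ℕ → α))) : Plane :=
  !₂[compoundSum (g 0) ω.1 + compoundSum (g 0) ω.2.1,
    compoundSum (g 1) ω.1 + compoundSum (g 1) ω.2.2]

theorem enorm_sq_plane (x : Plane) : ‖x‖ₑ ^ 2 = ‖x 0‖ₑ ^ 2 + ‖x 1‖ₑ ^ 2 := by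
  simp only [← ofReal_norm]
  rw [← ENNReal.ofReal_pow (norm_nonneg _), ← ENNReal.ofReal_pow (norm_nonneg _),
    ← ENNReal.ofReal_pow (norm_nonneg _), ← ENNReal.ofReal_add (by positivity) (by positivity),
    EuclideanSpace.norm_sq_eq, Fin.sum_univ_two]

/-- The shared block correlates the coordinates, but the squared Euclidean norm has no term mixing
them. Each coordinate is a sum of two independent blocks with total mean `t d + (1 - t) d = d`. -/
theorem lintegral_enorm_sq_compoundVector {d t : ℝ} (hd : 0 ≤ d) (ht0 : 0 ≤ t) (ht1 : t ≤ 1)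
    {g : Fin 2 → α → ℝ} (hgm : ∀ h, Measurable (g h)) (hg : ∀ h, MemLp (g h) 2 μ)
    (hg0 : ∀ h, ∫ a, g h a ∂μ = 0) :
    ∫⁻ ω, ‖compoundVector g ω‖ₑ ^ 2 ∂(sourceMeasure d t μ) =
      ENNReal.ofReal d * (∫⁻ a, ‖g 0 a‖ₑ ^ 2 ∂μ + ∫⁻ a, ‖g 1 a‖ₑ ^ 2 ∂μ) := by
  have hm h := measurable_compoundSum (hgm h)
  have hmem (lam : ℝ) h := memLp_compoundSum lam (hgm h) (hg h) (hg0 h)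
  have hmean (lam : ℝ) h := integral_compoundSum lam (hgm h) (hg h) (hg0 h)
  have hsec (lam : ℝ) h := lintegral_enorm_sq_compoundSum lam (hgm h) (hg h) (hg0 h)
  have hadd : ENNReal.ofReal (t * d) + ENNReal.ofReal ((1 - t) * d) = ENNReal.ofReal d := by
    rw [← ENNReal.ofReal_add (by positivity) (mul_nonneg (by linarith) hd)]
    ring_nf
  have h0 : ∫⁻ ω, ‖compoundSum (g 0) ω.1 + compoundSum (g 0) ω.2.1‖ₑ ^ 2 ∂(sourceMeasure d t μ) =
      ENNReal.ofReal d * ∫⁻ a, ‖g 0 a‖ₑ ^ 2 ∂μ := by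
    have hY : MemLp (fun ω : (ℕ × (ℕ → α)) × (ℕ × (ℕ → α)) => compoundSum (g 0) ω.1) 2
        ((compoundMeasure ((1 - t) * d) μ).prod (compoundMeasure ((1 - t) * d) μ)) :=
      (hmem _ 0).comp_measurePreserving measurePreserving_fst
    rw [sourceMeasure, lintegral_enorm_sq_add_prod (hmem _ 0) hY (hmean _ 0),
      measurePreserving_fst.lintegral_comp (f := fun b => ‖compoundSum (g 0) b‖ₑ ^ 2)
        ((hm 0).enorm.pow_const 2), hsec, hsec, ← add_mul, hadd]
  have h1 : ∫⁻ ω, ‖compoundSum (g 1) ω.1 + compoundSum (g 1) ω.2.2‖ₑ ^ 2 ∂(sourceMeasure d t μ) =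
      ENNReal.ofReal d * ∫⁻ a, ‖g 1 a‖ₑ ^ 2 ∂μ := by
    have hY : MemLp (fun ω : (ℕ × (ℕ → α)) × (ℕ × (ℕ → α)) => compoundSum (g 1) ω.2) 2
        ((compoundMeasure ((1 - t) * d) μ).prod (compoundMeasure ((1 - t) * d) μ)) :=
      (hmem _ 1).comp_measurePreserving measurePreserving_snd
    rw [sourceMeasure, lintegral_enorm_sq_add_prod (hmem _ 1) hY (hmean _ 1),
      measurePreserving_snd.lintegral_comp (f := fun b => ‖compoundSum (g 1) b‖ₑ ^ 2)
        ((hm 1).enorm.pow_const 2), hsec, hsec, ← add_mul, hadd]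
  have hcoord (ω) : ‖compoundVector g ω‖ₑ ^ 2 =
      ‖compoundSum (g 0) ω.1 + compoundSum (g 0) ω.2.1‖ₑ ^ 2 +
        ‖compoundSum (g 1) ω.1 + compoundSum (g 1) ω.2.2‖ₑ ^ 2 := enorm_sq_plane _
  simp only [hcoord]
  rw [lintegral_add_left, h0, h1, mul_add]
  exact (((hm 0).comp measurable_fst).add ((hm 0).comp measurable_snd.fst)).enorm.pow_const 2

/-- Pushing forward the marks of a block. -/
def mapBlock (π : α → β) (b : ℕ × (ℕ → α)) : ℕ × (ℕ → β) := (b.1, fun i => π (b.2 i))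

theorem measurePreserving_mapBlock (lam : ℝ) {π : α → β} {ν : Measure β} [IsProbabilityMeasure ν]
    (hπ : MeasurePreserving π μ ν) :
    MeasurePreserving (mapBlock π) (compoundMeasure lam μ) (compoundMeasure lam ν) := by
  have hinf : MeasurePreserving (fun (x : ℕ → α) i => π (x i)) (Measure.infinitePi fun _ => μ)
      (Measure.infinitePi fun _ => ν) := by
    refine ⟨measurable_pi_lambda _ fun i => hπ.measurable.comp (measurable_pi_apply i), ?_⟩
    rw [Measure.infinitePi_map_pi _ fun _ => hπ.measurable]
    simp only [hπ.map_eq]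
  exact (MeasurePreserving.id _).prod hinf

/-- Used to project a source of coupled marks onto the sources of its two marginals. -/
theorem measurePreserving_mapBlock_prod (d t : ℝ) {π : α → β} {ν : Measure β}
    [IsProbabilityMeasure ν] (hπ : MeasurePreserving π μ ν) :
    MeasurePreserving (Prod.map (mapBlock π) (Prod.map (mapBlock π) (mapBlock π)))
      (sourceMeasure d t μ) (sourceMeasure d t ν) :=
  (measurePreserving_mapBlock _ hπ).prod
    ((measurePreserving_mapBlock _ hπ).prod (measurePreserving_mapBlock _ hπ))

end CompoundSums

/-! ### Analysis of the log-tanh function -/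

section LogTanh

/-- The function `log ((1 + r * tanh (x / 2)) / 2)`. -/
def logTanh (x r : ℝ) : ℝ := Real.log (1 / 2 * (1 + r * Real.tanh (x / 2)))

theorem half_one_add_tanh (x : ℝ) : 1 / 2 * (1 + Real.tanh (x / 2)) = (1 + Real.exp (-x))⁻¹ := by
  have h : Real.exp (-x) = Real.exp (-(x / 2)) * (Real.exp (x / 2))⁻¹ := by
    rw [← Real.exp_neg, ← Real.exp_add]; ring_nf
  rw [Real.tanh_eq, h]
  field_simp
  ring

theorem logTanh_one (x : ℝ) : logTanh x 1 = -Real.log (1 + Real.exp (-x)) := by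
  rw [logTanh, one_mul, half_one_add_tanh, Real.log_inv]

theorem logTanh_neg_one (x : ℝ) : logTanh x (-1) = -Real.log (1 + Real.exp x) := by
  have h : -1 * Real.tanh (x / 2) = Real.tanh (-x / 2) := by
    rw [neg_div, Real.tanh_neg]; ring
  rw [logTanh, h, half_one_add_tanh, Real.log_inv, neg_neg]

theorem logTanh_one_sub (x : ℝ) : logTanh x 1 - logTanh x (-1) = x := by
  have h : 1 + Real.exp x = Real.exp x * (1 + Real.exp (-x)) := by
    rw [mul_add, ← Real.exp_add]; simp [add_comm]
  rw [logTanh_one, logTanh_neg_one, h, Real.log_mul (by positivity) (by positivity), Real.log_exp]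
  ring

theorem logTanh_one_mono : Monotone fun x => logTanh x 1 := by
  intro x y h
  simp only [logTanh_one]
  gcongr

theorem logTanh_neg_one_anti : Antitone fun x => logTanh x (-1) := by
  intro x y h
  simp only [logTanh_neg_one]
  gcongr

/-- One increment is monotone in the argument and the other antitone, so their product is
nonpositive; their difference is `x - y`, and expanding its square gives the bound. -/
theorem logTanh_sq_sub_le (x y : ℝ) :
    (logTanh x 1 - logTanh y 1) ^ 2 + (logTanh x (-1) - logTanh y (-1)) ^ 2 ≤ (x - y) ^ 2 := by
  have hmul : (logTanh x 1 - logTanh y 1) * (logTanh x (-1) - logTanh y (-1)) ≤ 0 := by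
    rcases le_total x y with h | h
    · exact mul_nonpos_of_nonpos_of_nonneg (sub_nonpos.2 (logTanh_one_mono h))
        (sub_nonneg.2 (logTanh_neg_one_anti h))
    · exact mul_nonpos_of_nonneg_of_nonpos (sub_nonneg.2 (logTanh_one_mono h))
        (sub_nonpos.2 (logTanh_neg_one_anti h))
  have hx := logTanh_one_sub x
  have hy := logTanh_one_sub y
  have : x - y = (logTanh x 1 - logTanh y 1) - (logTanh x (-1) - logTanh y (-1)) := by
    linarith
  rw [this]
  nlinarith

theorem logTanh_zero (r : ℝ) : logTanh 0 r = -Real.log 2 := by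
  simp [logTanh]

theorem add_sq_le_of_pos {ε : ℝ} (hε : 0 < ε) (u c : ℝ) :
    (u + c) ^ 2 ≤ (1 + ε) * u ^ 2 + (1 + ε⁻¹) * c ^ 2 := by
  have h : (1 + ε) * u ^ 2 + (1 + ε⁻¹) * c ^ 2 - (u + c) ^ 2 = ε⁻¹ * (ε * u - c) ^ 2 := by
    field_simp
    ring
  nlinarith [mul_nonneg (inv_nonneg.2 hε.le) (sq_nonneg (ε * u - c))]

/-- Comparison with the value `-log 2` at the origin. The coefficient of `x ^ 2` must be allowed
arbitrarily close to `1`, so that the second moment recursion still contracts for `d` near `2`. -/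
theorem logTanh_sq_le {ε : ℝ} (hε : 0 < ε) (x : ℝ) :
    logTanh x 1 ^ 2 + logTanh x (-1) ^ 2 ≤
      (1 + ε) * x ^ 2 + 2 * ((1 + ε⁻¹) * Real.log 2 ^ 2) := by
  have h := logTanh_sq_sub_le x 0
  simp only [logTanh_zero, sub_neg_eq_add, sub_zero] at h
  have h1 := add_sq_le_of_pos hε (logTanh x 1 + Real.log 2) (-Real.log 2)
  have h2 := add_sq_le_of_pos hε (logTanh x (-1) + Real.log 2) (-Real.log 2)
  simp only [add_neg_cancel_right, neg_sq] at h1 h2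
  have h3 := mul_le_mul_of_nonneg_left h (by linarith : 0 ≤ 1 + ε)
  linarith

theorem continuous_tanh : Continuous Real.tanh := by
  have : Real.tanh = fun x => Real.sinh x / Real.cosh x :=
    funext Real.tanh_eq_sinh_div_cosh
  rw [this]
  exact Real.continuous_sinh.div Real.continuous_cosh fun x => (Real.cosh_pos x).ne'

theorem measurable_logTanh : Measurable fun p : ℝ × ℝ => logTanh p.1 p.2 := by
  have htanh := continuous_tanh.measurable
  unfold logTanh
  fun_prop

theorem continuous_logTanh_one : Continuous fun x => logTanh x 1 := by
  simp only [logTanh_one]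
  exact (Continuous.log (by fun_prop) fun x => by positivity).neg

theorem continuous_logTanh_neg_one : Continuous fun x => logTanh x (-1) := by
  simp only [logTanh_neg_one]
  exact (Continuous.log (by fun_prop) fun x => by positivity).neg

end LogTanh

/-! ### Averaging over the random signs -/

section Signs

theorem lintegral_signMeasure (f : ℝ → ENNReal) :
    ∫⁻ s, f s ∂signMeasure = 2⁻¹ * (f 1 + f (-1)) := by
  simp [signMeasure, lintegral_add_measure, lintegral_smul_measure, lintegral_dirac, mul_add]

theorem integral_signMeasure {E : Type*} [NormedAddCommGroup E] [NormedSpace ℝ E]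
    [CompleteSpace E] (f : ℝ → E) :
    ∫ s, f s ∂signMeasure = (2⁻¹ : ℝ) • (f 1 + f (-1)) := by
  have h (x : ℝ) : Integrable f ((2⁻¹ : ENNReal) • Measure.dirac x) :=
    (integrable_dirac (by simp)).smul_measure (by simp)
  rw [signMeasure, integral_add_measure (h 1) (h (-1))]
  simp [integral_smul_measure, smul_add]

theorem measurePreserving_neg_signMeasure :
    MeasurePreserving (fun s : ℝ => -s) signMeasure signMeasure := by
  refine ⟨measurable_neg, ?_⟩
  rw [signMeasure, Measure.map_add _ _ measurable_neg, Measure.map_smul, Measure.map_smul,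
    Measure.map_dirac, Measure.map_dirac, neg_neg, add_comm]

variable {β : Type*} [MeasurableSpace β] {η : Measure β}
  {κ : β → ℝ → ℝ}

/-- A function of a mark, multiplied by the first sign. -/
def signed (κ : β → ℝ → ℝ) (a : β × ℝ × ℝ) : ℝ := a.2.1 * κ a.1 a.2.2

theorem measurable_signed (hκ : Measurable fun p : β × ℝ => κ p.1 p.2) :
    Measurable (signed κ) :=
  measurable_snd.fst.mul (hκ.comp (measurable_fst.prodMk measurable_snd.snd))

theorem lintegral_enorm_sq_signed (hκ : Measurable fun p : β × ℝ => κ p.1 p.2) :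
    ∫⁻ a, ‖signed κ a‖ₑ ^ 2 ∂(η.prod (signMeasure.prod signMeasure)) =
      ∫⁻ b, 2⁻¹ * (‖κ b 1‖ₑ ^ 2 + ‖κ b (-1)‖ₑ ^ 2) ∂η := by
  have hm : Measurable fun a : β × ℝ × ℝ => ‖signed κ a‖ₑ ^ 2 :=
    (measurable_signed hκ).enorm.pow_const 2
  rw [lintegral_prod _ hm.aemeasurable]
  refine lintegral_congr fun b => ?_
  have hm' : Measurable fun y : ℝ × ℝ => ‖signed κ (b, y)‖ₑ ^ 2 := hm.comp measurable_prodMk_left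
  rw [lintegral_prod _ hm'.aemeasurable]
  simp only [lintegral_signMeasure, signed, one_mul, neg_one_mul, enorm_neg]
  rw [← two_mul, ← mul_assoc, ENNReal.inv_mul_cancel (by simp) (by simp), one_mul]

/-- Flipping the first sign preserves the law and negates the integrand. No integrability is needed,
since the change of variables holds for the Bochner integral in any case. -/
theorem integral_signed [SFinite η] (hκ : Measurable fun p : β × ℝ => κ p.1 p.2) :
    ∫ a, signed κ a ∂(η.prod (signMeasure.prod signMeasure)) = 0 := by
  have hmp : MeasurePreserving (Prod.map id (Prod.map (fun s : ℝ => -s) id))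
      (η.prod (signMeasure.prod signMeasure)) (η.prod (signMeasure.prod signMeasure)) :=
    (MeasurePreserving.id η).prod (measurePreserving_neg_signMeasure.prod (MeasurePreserving.id _))
  have h := integral_map (μ := η.prod (signMeasure.prod signMeasure)) (f := signed κ)
    hmp.measurable.aemeasurable (measurable_signed hκ).aestronglyMeasurable
  rw [hmp.map_eq] at h
  have hneg : ∀ a : β × ℝ × ℝ,
      signed κ (Prod.map id (Prod.map (fun s : ℝ => -s) id) a) = -signed κ a := fun a => by
    simp [signed]
  simp only [hneg, integral_neg] at h
  linarith

theorem memLp_signed (hκ : Measurable fun p : β × ℝ => κ p.1 p.2)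
    (h : ∫⁻ b, 2⁻¹ * (‖κ b 1‖ₑ ^ 2 + ‖κ b (-1)‖ₑ ^ 2) ∂η < ⊤) :
    MemLp (signed κ) 2 (η.prod (signMeasure.prod signMeasure)) := by
  rwa [memLp_two_iff_lintegral (measurable_signed hκ), lintegral_enorm_sq_signed hκ]

end Signs

/-! ### Second moment of the updated law -/

theorem measurable_coord (h : Fin 2) : Measurable fun x : Plane => x h :=
  (EuclideanSpace.proj (𝕜 := ℝ) h).continuous.measurable

theorem measurable_enorm_coord (h : Fin 2) : Measurable fun x : Plane => ‖x h‖ₑ ^ 2 :=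
  (measurable_coord h).enorm.pow_const 2

/-- The contribution of a mark to the coordinate `h`. -/
def summand (h : Fin 2) : Mark → ℝ := signed fun x r => logTanh (x h) r

theorem measurable_summand_kernel (h : Fin 2) :
    Measurable fun p : Plane × ℝ => logTanh (p.1 h) p.2 :=
  measurable_logTanh.comp (((measurable_coord h).comp measurable_fst).prodMk measurable_snd)

theorem measurable_summand (h : Fin 2) : Measurable (summand h) :=
  measurable_signed (measurable_summand_kernel h)

theorem updateVector_eq : updateVector = compoundVector summand := rfl

theorem logBP_eq (d t : ℝ) (ρ : ProbabilityMeasure Plane) :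
    (logBP d t ρ : Measure Plane) = (sourceMeasure d t (markMeasure ρ)).map updateVector := rfl

theorem enorm_sq_eq_ofReal (x : ℝ) : ‖x‖ₑ ^ 2 = ENNReal.ofReal (x ^ 2) := by
  rw [← enorm_pow, Real.enorm_eq_ofReal (sq_nonneg _)]

theorem half_logTanh_sub_le (x y : ℝ) :
    2⁻¹ * (‖logTanh x 1 - logTanh y 1‖ₑ ^ 2 + ‖logTanh x (-1) - logTanh y (-1)‖ₑ ^ 2) ≤
      2⁻¹ * ‖x - y‖ₑ ^ 2 := by
  simp only [enorm_sq_eq_ofReal]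
  rw [← ENNReal.ofReal_add (sq_nonneg _) (sq_nonneg _)]
  gcongr
  exact logTanh_sq_sub_le x y

theorem half_logTanh_le {ε : ℝ} (hε : 0 < ε) (x : ℝ) :
    2⁻¹ * (‖logTanh x 1‖ₑ ^ 2 + ‖logTanh x (-1)‖ₑ ^ 2) ≤
      ENNReal.ofReal ((1 + ε) / 2) * ‖x‖ₑ ^ 2 + ENNReal.ofReal ((1 + ε⁻¹) * Real.log 2 ^ 2) := by
  have h2 : (2⁻¹ : ENNReal) = ENNReal.ofReal 2⁻¹ := by
    rw [ENNReal.ofReal_inv_of_pos two_pos, ENNReal.ofReal_ofNat]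
  simp only [enorm_sq_eq_ofReal]
  rw [h2, ← ENNReal.ofReal_add (sq_nonneg _) (sq_nonneg _), ← ENNReal.ofReal_mul (by positivity),
    ← ENNReal.ofReal_mul (by positivity), ← ENNReal.ofReal_add (by positivity) (by positivity)]
  refine ENNReal.ofReal_le_ofReal ?_
  linarith [logTanh_sq_le hε x]

theorem lintegral_coord_add (ρ : Measure Plane) :
    ∫⁻ x, ‖x 0‖ₑ ^ 2 ∂ρ + ∫⁻ x, ‖x 1‖ₑ ^ 2 ∂ρ = ∫⁻ x, ‖x‖ₑ ^ 2 ∂ρ := by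
  rw [← lintegral_add_left ((measurable_coord 0).enorm.pow_const 2)]
  exact lintegral_congr fun x => (enorm_sq_plane x).symm

theorem enorm_coord_le (x : Plane) (h : Fin 2) : ‖x h‖ₑ ^ 2 ≤ ‖x‖ₑ ^ 2 := by
  rw [enorm_sq_plane]
  fin_cases h
  · exact le_self_add
  · exact le_add_self

theorem lintegral_const_mul_add_const {Ω : Type*} [MeasurableSpace Ω] {P : Measure Ω}
    [IsProbabilityMeasure P] {f : Ω → ENNReal} (hf : Measurable f) (a c : ENNReal) :
    ∫⁻ ω, a * f ω + c ∂P = a * ∫⁻ ω, f ω ∂P + c := by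
  rw [lintegral_add_right _ measurable_const, lintegral_const_mul _ hf, lintegral_const,
    measure_univ, mul_one]

/-- The affine bound of the second moment after one application of the operator. -/
theorem lintegral_logBP_le {d t ε : ℝ} (hd : 0 ≤ d) (ht0 : 0 ≤ t) (ht1 : t ≤ 1) (hε : 0 < ε)
    {ρ : ProbabilityMeasure Plane} (hρ : FiniteSecondMoment ρ) :
    ∫⁻ x, ‖x‖ₑ ^ 2 ∂(logBP d t ρ : Measure Plane) ≤
      ENNReal.ofReal (d * ((1 + ε) / 2)) * ∫⁻ x, ‖x‖ₑ ^ 2 ∂(ρ : Measure Plane) +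
        ENNReal.ofReal (d * (2 * ((1 + ε⁻¹) * Real.log 2 ^ 2))) := by
  have hbound (h : Fin 2) :
      ∫⁻ x : Plane, 2⁻¹ * (‖logTanh (x h) 1‖ₑ ^ 2 + ‖logTanh (x h) (-1)‖ₑ ^ 2)
        ∂(ρ : Measure Plane) ≤
        ENNReal.ofReal ((1 + ε) / 2) * ∫⁻ x : Plane, ‖x h‖ₑ ^ 2 ∂(ρ : Measure Plane) +
          ENNReal.ofReal ((1 + ε⁻¹) * Real.log 2 ^ 2) := by
    rw [← lintegral_const_mul_add_const (measurable_enorm_coord h)]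
    exact lintegral_mono fun x => half_logTanh_le hε (x h)
  have hfin (h : Fin 2) : ∫⁻ x : Plane, ‖x h‖ₑ ^ 2 ∂(ρ : Measure Plane) < ⊤ :=
    (lintegral_mono fun x => enorm_coord_le x h).trans_lt hρ
  have hmem (h : Fin 2) : MemLp (summand h) 2 (markMeasure ρ) :=
    memLp_signed (measurable_summand_kernel h) ((hbound h).trans_lt (ENNReal.add_lt_top.2
      ⟨ENNReal.mul_lt_top ENNReal.ofReal_lt_top (hfin h), ENNReal.ofReal_lt_top⟩))
  have hsec (h : Fin 2) := (lintegral_enorm_sq_signed (η := (ρ : Measure Plane))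
    (measurable_summand_kernel h)).trans_le (hbound h)
  rw [logBP_eq, lintegral_map (by fun_prop) measurable_updateVector, updateVector_eq,
    lintegral_enorm_sq_compoundVector (g := summand) hd ht0 ht1 measurable_summand hmem
      fun h => integral_signed (measurable_summand_kernel h)]
  refine (mul_le_mul_right (add_le_add (hsec 0) (hsec 1)) _).trans_eq ?_
  rw [← lintegral_coord_add, ENNReal.ofReal_mul hd, ENNReal.ofReal_mul hd,
    ENNReal.ofReal_mul two_pos.le, ENNReal.ofReal_ofNat]
  ring

/-! ### The coupling behind the contraction -/

/-- The difference of the contributions of two coupled marks to the coordinate `h`. -/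
def summandDiff (h : Fin 2) : (Plane × Plane) × ℝ × ℝ → ℝ :=
  signed fun p r => logTanh (p.1 h) r - logTanh (p.2 h) r

theorem measurable_summandDiff_kernel (h : Fin 2) :
    Measurable fun q : (Plane × Plane) × ℝ => logTanh (q.1.1 h) q.2 - logTanh (q.1.2 h) q.2 :=
  ((measurable_summand_kernel h).comp (measurable_fst.fst.prodMk measurable_snd)).sub
    ((measurable_summand_kernel h).comp (measurable_fst.snd.prodMk measurable_snd))

theorem measurable_coord_sub (h : Fin 2) :
    Measurable fun p : Plane × Plane => ‖p.1 h - p.2 h‖ₑ ^ 2 :=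
  (((measurable_coord h).comp measurable_fst).sub
    ((measurable_coord h).comp measurable_snd)).enorm.pow_const 2

theorem enorm_coord_sub_le (p : Plane × Plane) (h : Fin 2) :
    ‖p.1 h - p.2 h‖ₑ ^ 2 ≤ ‖p.1 - p.2‖ₑ ^ 2 := by
  rw [← PiLp.sub_apply]
  exact enorm_coord_le _ h

theorem lintegral_summandDiff_le (γ : Measure (Plane × Plane)) (h : Fin 2) :
    ∫⁻ a, ‖summandDiff h a‖ₑ ^ 2 ∂(γ.prod (signMeasure.prod signMeasure)) ≤
      2⁻¹ * ∫⁻ p, ‖p.1 h - p.2 h‖ₑ ^ 2 ∂γ := by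
  rw [summandDiff, lintegral_enorm_sq_signed (measurable_summandDiff_kernel h),
    ← lintegral_const_mul _ (measurable_coord_sub h)]
  exact lintegral_mono fun p => half_logTanh_sub_le _ _

theorem lintegral_compoundVector_summandDiff_le {d t : ℝ} (hd : 0 ≤ d) (ht0 : 0 ≤ t) (ht1 : t ≤ 1)
    (γ : Measure (Plane × Plane)) [IsProbabilityMeasure γ]
    (hcost : ∫⁻ p, ‖p.1 - p.2‖ₑ ^ 2 ∂γ < ⊤) :
    ∫⁻ ω, ‖compoundVector summandDiff ω‖ₑ ^ 2
        ∂(sourceMeasure d t (γ.prod (signMeasure.prod signMeasure))) ≤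
      ENNReal.ofReal (d / 2) * ∫⁻ p, ‖p.1 - p.2‖ₑ ^ 2 ∂γ := by
  have hm (h : Fin 2) : Measurable (summandDiff h) :=
    measurable_signed (measurable_summandDiff_kernel h)
  have hfin (h : Fin 2) : ∫⁻ p, ‖p.1 h - p.2 h‖ₑ ^ 2 ∂γ < ⊤ :=
    (lintegral_mono fun p => enorm_coord_sub_le p h).trans_lt hcost
  have hmem (h : Fin 2) : MemLp (summandDiff h) 2 (γ.prod (signMeasure.prod signMeasure)) :=
    (memLp_two_iff_lintegral (hm h)).2 ((lintegral_summandDiff_le γ h).trans_lt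
      (ENNReal.mul_lt_top (by simp) (hfin h)))
  have hsplit : ∫⁻ p, ‖p.1 - p.2‖ₑ ^ 2 ∂γ =
      ∫⁻ p, ‖p.1 0 - p.2 0‖ₑ ^ 2 ∂γ + ∫⁻ p, ‖p.1 1 - p.2 1‖ₑ ^ 2 ∂γ := by
    rw [← lintegral_add_left (measurable_coord_sub 0)]
    refine lintegral_congr fun p => ?_
    rw [enorm_sq_plane, PiLp.sub_apply, PiLp.sub_apply]
  rw [lintegral_enorm_sq_compoundVector hd ht0 ht1 hm hmem
      fun h => integral_signed (measurable_summandDiff_kernel h)]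
  refine (mul_le_mul_right (add_le_add (lintegral_summandDiff_le γ 0)
    (lintegral_summandDiff_le γ 1)) _).trans_eq ?_
  rw [← mul_add, ← hsplit, ← mul_assoc, div_eq_mul_inv,
    ENNReal.ofReal_mul hd, ENNReal.ofReal_inv_of_pos two_pos, ENNReal.ofReal_ofNat]

/-- Applying a map to all marks of three blocks. -/
abbrev mapBlocks {α β : Type*} (π : α → β) :
    (ℕ × (ℕ → α)) × (ℕ × (ℕ → α)) × (ℕ × (ℕ → α)) →
      (ℕ × (ℕ → β)) × (ℕ × (ℕ → β)) × (ℕ × (ℕ → β)) :=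
  Prod.map (mapBlock π) (Prod.map (mapBlock π) (mapBlock π))

/-- Both projections keep the numbers of terms and the signs, so the sums can be subtracted term by
term. -/
theorem updateVector_sub (ω : (ℕ × (ℕ → (Plane × Plane) × ℝ × ℝ)) ×
      (ℕ × (ℕ → (Plane × Plane) × ℝ × ℝ)) × (ℕ × (ℕ → (Plane × Plane) × ℝ × ℝ))) :
    updateVector (mapBlocks (Prod.map Prod.fst id) ω) -
      updateVector (mapBlocks (Prod.map Prod.snd id) ω) = compoundVector summandDiff ω := by
  have hsum (h : Fin 2) (b : ℕ × (ℕ → (Plane × Plane) × ℝ × ℝ)) :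
      compoundSum (summandDiff h) b = blockSum h (mapBlock (Prod.map Prod.fst id) b) -
        blockSum h (mapBlock (Prod.map Prod.snd id) b) := by
    simp only [compoundSum, blockSum, mapBlock, ← Finset.sum_sub_distrib]
    exact Finset.sum_congr rfl fun i _ => mul_sub _ _ _
  ext h
  fin_cases h
  · change blockSum 0 _ + blockSum 0 _ - (blockSum 0 _ + blockSum 0 _) =
      compoundSum _ _ + compoundSum _ _
    rw [hsum, hsum]
    exact add_sub_add_comm _ _ _ _
  · change blockSum 1 _ + blockSum 1 _ - (blockSum 1 _ + blockSum 1 _) =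
      compoundSum _ _ + compoundSum _ _
    rw [hsum, hsum]
    exact add_sub_add_comm _ _ _ _

/-- The operator does not increase the costs of couplings by more than the factor `d / 2`. -/
theorem exists_coupling_logBP {d t : ℝ} (hd : 0 ≤ d) (ht0 : 0 ≤ t) (ht1 : t ≤ 1)
    {ρ ν : ProbabilityMeasure Plane} {γ : Measure (Plane × Plane)} (hγ : γ ∈ couplings ρ ν)
    (hcost : ∫⁻ p, ‖p.1 - p.2‖ₑ ^ 2 ∂γ < ⊤) :
    ∃ γ' ∈ couplings (logBP d t ρ) (logBP d t ν),
      ∫⁻ p, ‖p.1 - p.2‖ₑ ^ 2 ∂γ' ≤ ENNReal.ofReal (d / 2) * ∫⁻ p, ‖p.1 - p.2‖ₑ ^ 2 ∂γ := by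
  have hfst : MeasurePreserving Prod.fst γ (ρ : Measure Plane) := ⟨measurable_fst, hγ.1⟩
  have hsnd : MeasurePreserving Prod.snd γ (ν : Measure Plane) := ⟨measurable_snd, hγ.2⟩
  -- Couplings are specified by their marginals only; the total mass is read off the first one.
  have : IsProbabilityMeasure γ := by
    refine ⟨?_⟩
    have h := hfst.measure_preimage (s := Set.univ) MeasurableSet.univ.nullMeasurableSet
    simpa using h
  have h1 : MeasurePreserving (Prod.map Prod.fst id) (γ.prod (signMeasure.prod signMeasure))
      (markMeasure ρ) := hfst.prod (MeasurePreserving.id _)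
  have h2 : MeasurePreserving (Prod.map Prod.snd id) (γ.prod (signMeasure.prod signMeasure))
      (markMeasure ν) := hsnd.prod (MeasurePreserving.id _)
  have H1 := measurePreserving_mapBlock_prod d t h1
  have H2 := measurePreserving_mapBlock_prod d t h2
  have hV1 : Measurable fun ω => updateVector (mapBlocks (Prod.map Prod.fst id) ω) :=
    measurable_updateVector.comp H1.measurable
  have hV2 : Measurable fun ω => updateVector (mapBlocks (Prod.map Prod.snd id) ω) :=
    measurable_updateVector.comp H2.measurable
  refine ⟨(sourceMeasure d t (γ.prod (signMeasure.prod signMeasure))).map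
    fun ω => (updateVector (mapBlocks (Prod.map Prod.fst id) ω),
      updateVector (mapBlocks (Prod.map Prod.snd id) ω)), ⟨?_, ?_⟩, ?_⟩
  · rw [Measure.map_map measurable_fst (hV1.prodMk hV2), logBP_eq, ← H1.map_eq,
      Measure.map_map measurable_updateVector H1.measurable]
    rfl
  · rw [Measure.map_map measurable_snd (hV1.prodMk hV2), logBP_eq, ← H2.map_eq,
      Measure.map_map measurable_updateVector H2.measurable]
    rfl
  · rw [lintegral_map (by fun_prop) (hV1.prodMk hV2)]
    simp only [updateVector_sub]
    exact lintegral_compoundVector_summandDiff_le hd ht0 ht1 γ hcost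

/-! ### Wasserstein distance and characteristic functions -/

section Wasserstein

theorem measurePreserving_fst_of_mem_couplings {ρ ν : ProbabilityMeasure Plane}
    {γ : Measure (Plane × Plane)} (hγ : γ ∈ couplings ρ ν) :
    MeasurePreserving Prod.fst γ (ρ : Measure Plane) := ⟨measurable_fst, hγ.1⟩

theorem measurePreserving_snd_of_mem_couplings {ρ ν : ProbabilityMeasure Plane}
    {γ : Measure (Plane × Plane)} (hγ : γ ∈ couplings ρ ν) :
    MeasurePreserving Prod.snd γ (ν : Measure Plane) := ⟨measurable_snd, hγ.2⟩

theorem enorm_sub_sq_le {E : Type*} [SeminormedAddCommGroup E] (x y : E) :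
    ‖x - y‖ₑ ^ 2 ≤ 2 * (‖x‖ₑ ^ 2 + ‖y‖ₑ ^ 2) := by
  simp only [← ofReal_norm]
  rw [← ENNReal.ofReal_pow (norm_nonneg _), ← ENNReal.ofReal_pow (norm_nonneg _),
    ← ENNReal.ofReal_pow (norm_nonneg _), ← ENNReal.ofReal_add (by positivity) (by positivity),
    ← ENNReal.ofReal_ofNat 2, ← ENNReal.ofReal_mul (by norm_num)]
  refine ENNReal.ofReal_le_ofReal ?_
  have h := norm_sub_le x y
  nlinarith [norm_nonneg (x - y), sq_nonneg (‖x‖ - ‖y‖)]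

theorem coupling_cost_lt_top {ρ ν : ProbabilityMeasure Plane} (hρ : FiniteSecondMoment ρ)
    (hν : FiniteSecondMoment ν) {γ : Measure (Plane × Plane)} (hγ : γ ∈ couplings ρ ν) :
    ∫⁻ p, ‖p.1 - p.2‖ₑ ^ 2 ∂γ < ⊤ := by
  have hm : Measurable fun x : Plane => ‖x‖ₑ ^ 2 := by fun_prop
  have h1 : ∫⁻ p, ‖p.1‖ₑ ^ 2 ∂γ = ∫⁻ x, ‖x‖ₑ ^ 2 ∂(ρ : Measure Plane) :=
    (measurePreserving_fst_of_mem_couplings hγ).lintegral_comp hm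
  have h2 : ∫⁻ p, ‖p.2‖ₑ ^ 2 ∂γ = ∫⁻ x, ‖x‖ₑ ^ 2 ∂(ν : Measure Plane) :=
    (measurePreserving_snd_of_mem_couplings hγ).lintegral_comp hm
  have hm1 : Measurable fun p : Plane × Plane => ‖p.1‖ₑ ^ 2 := by fun_prop
  have hm2 : Measurable fun p : Plane × Plane => ‖p.2‖ₑ ^ 2 := by fun_prop
  calc ∫⁻ p, ‖p.1 - p.2‖ₑ ^ 2 ∂γ ≤ ∫⁻ p, 2 * (‖p.1‖ₑ ^ 2 + ‖p.2‖ₑ ^ 2) ∂γ :=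
        lintegral_mono fun p => enorm_sub_sq_le p.1 p.2
    _ = 2 * (∫⁻ p, ‖p.1‖ₑ ^ 2 ∂γ + ∫⁻ p, ‖p.2‖ₑ ^ 2 ∂γ) := by
        rw [← lintegral_add_left hm1]
        exact lintegral_const_mul _ (hm1.add hm2)
    _ < ⊤ := by
        rw [h1, h2]
        exact ENNReal.mul_lt_top (by simp) (ENNReal.add_lt_top.2 ⟨hρ, hν⟩)

theorem wasserstein2_lt_top {ρ ν : ProbabilityMeasure Plane} (hρ : FiniteSecondMoment ρ)
    (hν : FiniteSecondMoment ν) : wasserstein2 ρ ν < ⊤ := by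
  have hγ : (ρ : Measure Plane).prod ν ∈ couplings ρ ν :=
    ⟨by simp [Measure.map_fst_prod], by simp [Measure.map_snd_prod]⟩
  exact (iInf₂_le _ hγ).trans_lt
    (ENNReal.rpow_lt_top_of_nonneg (by norm_num) (coupling_cost_lt_top hρ hν hγ).ne)

/-- No optimal coupling is needed: every coupling has finite cost and yields a coupling of the
images, and the infimum is taken afterwards. -/
theorem wasserstein2_logBP_le {d t : ℝ} (hd : 0 < d) (ht0 : 0 ≤ t) (ht1 : t ≤ 1)
    {ρ ν : ProbabilityMeasure Plane} (hρ : FiniteSecondMoment ρ) (hν : FiniteSecondMoment ν) :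
    wasserstein2 (logBP d t ρ) (logBP d t ν) ≤
      ENNReal.ofReal (Real.sqrt (d / 2)) * wasserstein2 ρ ν := by
  have hc : ENNReal.ofReal (Real.sqrt (d / 2)) ≠ 0 := by
    rw [Ne, ENNReal.ofReal_eq_zero, not_le]
    positivity
  rw [wasserstein2, wasserstein2, ENNReal.mul_iInf_of_ne hc ENNReal.ofReal_ne_top]
  simp only [ENNReal.mul_iInf_of_ne hc ENNReal.ofReal_ne_top]
  refine le_iInf₂ fun γ hγ => ?_
  obtain ⟨γ', hγ', hle⟩ :=
    exists_coupling_logBP hd.le ht0 ht1 hγ (coupling_cost_lt_top hρ hν hγ)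
  refine (iInf₂_le γ' hγ').trans ?_
  rw [Real.sqrt_eq_rpow, ← ENNReal.ofReal_rpow_of_nonneg (by positivity) (by norm_num),
    ← ENNReal.mul_rpow_of_nonneg _ _ (by norm_num)]
  exact ENNReal.rpow_le_rpow hle (by norm_num)

theorem enorm_exp_sub_exp_le (a b : ℝ) :
    ‖Complex.exp (a * Complex.I) - Complex.exp (b * Complex.I)‖ₑ ≤ ‖a - b‖ₑ := by
  have h : Complex.exp (a * Complex.I) - Complex.exp (b * Complex.I) =
      Complex.exp (b * Complex.I) * (Complex.exp (Complex.I * (a - b : ℝ)) - 1) := by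
    rw [mul_sub, ← Complex.exp_add, mul_one]
    congr 2
    push_cast
    ring
  rw [h, enorm_mul, ← ofReal_norm, Complex.norm_exp_ofReal_mul_I, ENNReal.ofReal_one, one_mul]
  exact Real.enorm_exp_I_mul_ofReal_sub_one_le

theorem lintegral_le_rpow_half {Ω : Type*} [MeasurableSpace Ω] (P : Measure Ω)
    [IsProbabilityMeasure P] {f : Ω → ENNReal} (hf : AEMeasurable f P) :
    ∫⁻ ω, f ω ∂P ≤ (∫⁻ ω, f ω ^ 2 ∂P) ^ (1 / 2 : ℝ) := by
  -- Cauchy–Schwarz against the constant `1`.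
  have h := ENNReal.lintegral_mul_le_Lp_mul_Lq P (p := 2) (q := 2)
    ⟨by norm_num, by norm_num, by norm_num⟩ hf
    (aemeasurable_const (b := (1 : ENNReal)))
  simpa using h

/-- The characteristic functions are Lipschitz for the Wasserstein distance. -/
theorem enorm_charFun_sub_le (ρ ν : ProbabilityMeasure Plane) (u : Plane) :
    ‖charFun (ρ : Measure Plane) u - charFun (ν : Measure Plane) u‖ₑ ≤
      ‖u‖ₑ * wasserstein2 ρ ν := by
  rcases eq_or_ne u 0 with rfl | hu
  · simp
  have hu' : ‖u‖ₑ ≠ 0 := by simpa using hu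
  rw [wasserstein2, ENNReal.mul_iInf_of_ne hu' (by simp)]
  simp only [ENNReal.mul_iInf_of_ne hu' (enorm_ne_top (x := u))]
  refine le_iInf₂ fun γ hγ => ?_
  have hfst := measurePreserving_fst_of_mem_couplings hγ
  have hsnd := measurePreserving_snd_of_mem_couplings hγ
  have : IsProbabilityMeasure γ := by
    refine ⟨?_⟩
    have h := hfst.measure_preimage (s := Set.univ) MeasurableSet.univ.nullMeasurableSet
    simpa using h
  have hint (f : Plane × Plane → ℝ) (hf : Measurable f) :
      Integrable (fun p => Complex.exp (f p * Complex.I)) γ :=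
    Integrable.of_bound (C := 1) (by fun_prop) (Eventually.of_forall fun p => by
      rw [Complex.norm_exp_ofReal_mul_I])
  have h1 : charFun (ρ : Measure Plane) u =
      ∫ p, Complex.exp ((inner ℝ p.1 u : ℝ) * Complex.I) ∂γ := by
    rw [charFun_apply, ← hγ.1, integral_map measurable_fst.aemeasurable (by fun_prop)]
  have h2 : charFun (ν : Measure Plane) u =
      ∫ p, Complex.exp ((inner ℝ p.2 u : ℝ) * Complex.I) ∂γ := by
    rw [charFun_apply, ← hγ.2, integral_map measurable_snd.aemeasurable (by fun_prop)]
  rw [h1, h2, ← integral_sub (hint _ (by fun_prop)) (hint _ (by fun_prop))]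
  calc _ ≤ ∫⁻ p : Plane × Plane, ‖u‖ₑ * ‖p.1 - p.2‖ₑ ∂γ := by
        refine (enorm_integral_le_lintegral_enorm _).trans (lintegral_mono fun p => ?_)
        refine (enorm_exp_sub_exp_le _ _).trans ?_
        rw [← inner_sub_left, mul_comm]
        simp only [← ofReal_norm]
        rw [← ENNReal.ofReal_mul (norm_nonneg _)]
        exact ENNReal.ofReal_le_ofReal (norm_inner_le_norm _ _)
    _ = ‖u‖ₑ * ∫⁻ p : Plane × Plane, ‖p.1 - p.2‖ₑ ∂γ := lintegral_const_mul _ (by fun_prop)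
    _ ≤ _ := by
        gcongr
        exact lintegral_le_rpow_half γ (by fun_prop)

theorem eq_of_wasserstein2_eq_zero {ρ ν : ProbabilityMeasure Plane}
    (h : wasserstein2 ρ ν = 0) : ρ = ν := by
  apply Subtype.ext
  change (ρ : Measure Plane) = (ν : Measure Plane)
  refine Measure.ext_of_charFun (funext fun u => ?_)
  have := enorm_charFun_sub_le ρ ν u
  rw [h, mul_zero, nonpos_iff_eq_zero, enorm_eq_zero, sub_eq_zero] at this
  exact this

end Wasserstein

/-! ### Tightness and weak limits -/

section WeakConvergence

/-- Markov's inequality for the squared norm bounds all tails by `C / r ^ 2`. -/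
theorem isTightMeasureSet_of_lintegral_le {S : Set (Measure Plane)} {C : ENNReal} (hC : C ≠ ⊤)
    (hS : ∀ μ ∈ S, ∫⁻ x, ‖x‖ₑ ^ 2 ∂μ ≤ C) : IsTightMeasureSet S := by
  refine isTightMeasureSet_of_tendsto_measure_norm_gt ?_
  have hlim : Tendsto (fun r : ℝ => C / ENNReal.ofReal r ^ 2) atTop (𝓝 0) := by
    have h : Tendsto (fun r : ℝ => ENNReal.ofReal r ^ 2) atTop (𝓝 ⊤) := by
      have := (ENNReal.continuous_pow 2).tendsto ⊤
      rw [ENNReal.top_pow two_ne_zero] at this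
      exact this.comp ENNReal.tendsto_ofReal_atTop
    simpa using ENNReal.Tendsto.const_div h (Or.inr hC)
  refine tendsto_of_tendsto_of_tendsto_of_le_of_le' tendsto_const_nhds hlim
    (Eventually.of_forall fun _ => zero_le) ?_
  filter_upwards [eventually_gt_atTop 0] with r hr
  refine iSup₂_le fun μ hμ => ?_
  have hm : AEMeasurable (fun x : Plane => ‖x‖ₑ ^ 2) μ := by fun_prop
  refine (measure_mono fun x hx => ?_).trans ((meas_ge_le_lintegral_div hm
    (ε := ENNReal.ofReal r ^ 2) (by simpa using hr) (by simp)).trans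
      (ENNReal.div_le_div_right (hS μ hμ) _))
  have hx' : r < ‖x‖ := hx
  change ENNReal.ofReal r ^ 2 ≤ ‖x‖ₑ ^ 2
  rw [← ofReal_norm]
  gcongr

/-- Lower semicontinuity under weak convergence: the portmanteau inequality on open sets carries
over to nonnegative continuous integrands. -/
theorem lintegral_enorm_sq_le_of_tendsto {ρs : ℕ → ProbabilityMeasure Plane}
    {ρ : ProbabilityMeasure Plane} (h : Tendsto ρs atTop (𝓝 ρ)) {C : ENNReal}
    (hC : ∀ n, ∫⁻ x, ‖x‖ₑ ^ 2 ∂(ρs n : Measure Plane) ≤ C) :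
    ∫⁻ x, ‖x‖ₑ ^ 2 ∂(ρ : Measure Plane) ≤ C := by
  have heq (μ : Measure Plane) :
      ∫⁻ x, ‖x‖ₑ ^ 2 ∂μ = ∫⁻ x, ENNReal.ofReal (‖x‖ ^ 2) ∂μ := by
    refine lintegral_congr fun x => ?_
    rw [ENNReal.ofReal_pow (norm_nonneg _), ofReal_norm]
  simp only [heq] at hC ⊢
  refine (lintegral_le_liminf_lintegral_of_forall_isOpen_measure_le_liminf_measure
    (μs := fun n => (ρs n : Measure Plane)) (f := fun x : Plane => ‖x‖ ^ 2) (by fun_prop)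
    (fun x => sq_nonneg _)
    fun G hG => ProbabilityMeasure.le_liminf_measure_open_of_tendsto h hG).trans ?_
  exact liminf_le_of_le (by isBoundedDefault) fun b hb => by
    obtain ⟨n, hn⟩ := hb.exists
    exact hn.trans (hC n)

/-- Weak sequential completeness for uniformly bounded second moments. -/
theorem exists_tendsto_of_cauchySeq_charFun {ρs : ℕ → ProbabilityMeasure Plane} {C : ENNReal}
    (hC : C ≠ ⊤) (hρs : ∀ n, ∫⁻ x, ‖x‖ₑ ^ 2 ∂(ρs n : Measure Plane) ≤ C)
    (hcauchy : ∀ u, CauchySeq fun n => charFun (ρs n : Measure Plane) u) :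
    ∃ ρ, Tendsto ρs atTop (𝓝 ρ) := by
  have htight : IsTightMeasureSet
      {((μ : ProbabilityMeasure Plane) : Measure Plane) | μ ∈ Set.range ρs} := by
    refine isTightMeasureSet_of_lintegral_le hC ?_
    rintro _ ⟨_, ⟨n, rfl⟩, rfl⟩
    exact hρs n
  -- Prokhorov gives a subsequential limit; the Cauchy property then makes the characteristic
  -- functions converge along the whole sequence.
  obtain ⟨ρ, -, φ, hφ, hlim⟩ := (isCompact_closure_of_isTightMeasureSet htight).tendsto_subseq
    (x := ρs) fun n => subset_closure ⟨n, rfl⟩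
  refine ⟨ρ, ProbabilityMeasure.tendsto_of_tendsto_charFun fun u => ?_⟩
  exact tendsto_nhds_of_cauchySeq_of_subseq (hcauchy u) hφ.tendsto_atTop
    (ProbabilityMeasure.tendsto_iff_tendsto_charFun.1 hlim u)

end WeakConvergence

/-! ### Weak continuity through characteristic functions -/

section CharFun

variable {α : Type*} [MeasurableSpace α] {μ : Measure α} [IsProbabilityMeasure μ]

/-- The characteristic exponential of a compound Poisson sum. -/
theorem integral_exp_compoundSum {lam : ℝ} (hlam : 0 ≤ lam) {g : α → ℝ} (hg : Measurable g) :
    ∫ b, Complex.exp (compoundSum g b * Complex.I) ∂(compoundMeasure lam μ) =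
      Complex.exp (lam * (∫ a, Complex.exp (g a * Complex.I) ∂μ - 1)) := by
  set φ : ℂ := ∫ a, Complex.exp (g a * Complex.I) ∂μ
  have hm := measurable_compoundSum hg
  have hint : Integrable (fun b => Complex.exp (compoundSum g b * Complex.I))
      (compoundMeasure lam μ) :=
    Integrable.of_bound (C := 1) (by fun_prop) (Eventually.of_forall fun b => by
      rw [Complex.norm_exp_ofReal_mul_I])
  have hinner (n : ℕ) : ∫ x, Complex.exp (compoundSum g (n, x) * Complex.I)
      ∂(Measure.infinitePi fun _ : ℕ => μ) = φ ^ n := by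
    have hind : iIndepFun (fun (i : ℕ) (x : ℕ → α) => Complex.exp (g (x i) * Complex.I))
        (Measure.infinitePi fun _ => μ) :=
      iIndepFun_infinitePi (X := fun _ a => Complex.exp (g a * Complex.I)) (fun _ => by fun_prop)
    have hfin := (hind.precomp (Fin.val_injective (n := n))).integral_fun_prod_eq_prod_integral
      fun i => Measurable.aestronglyMeasurable (by fun_prop)
    have hterm (i : ℕ) : ∫ x, Complex.exp (g (x i) * Complex.I)
        ∂(Measure.infinitePi fun _ : ℕ => μ) = φ :=
      integral_eval_infinitePi (f := fun a => Complex.exp (g a * Complex.I))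
        (Measurable.aestronglyMeasurable (by fun_prop)) i
    simp only [hterm, Finset.prod_const, Finset.card_univ, Fintype.card_fin] at hfin
    rw [← hfin]
    refine integral_congr_ae (Eventually.of_forall fun x => ?_)
    simp only [compoundSum, Complex.ofReal_sum, Finset.sum_mul, Complex.exp_sum]
    exact Finset.prod_range _
  rw [compoundMeasure] at hint ⊢
  rw [integral_prod _ hint]
  simp only [hinner]
  -- What remains is the Poisson generating function at `φ`, an exponential series.
  rw [integral_poissonMeasure, Real.coe_toNNReal _ hlam]
  have hsum := (NormedSpace.expSeries_div_hasSum_exp (lam * φ : ℂ)).mul_left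
    (Complex.exp (-lam))
  rw [← Complex.exp_eq_exp_ℂ, ← Complex.exp_add] at hsum
  rw [show (lam : ℂ) * (φ - 1) = -lam + lam * φ by ring, ← hsum.tsum_eq]
  refine tsum_congr fun n => ?_
  rw [Complex.real_smul, mul_pow]
  push_cast
  ring

end CharFun

/-- The contribution of a mark to the inner product with `v`. -/
def markInner (v : Plane) (a : Mark) : ℝ := v 0 * summand 0 a + v 1 * summand 1 a

theorem measurable_markInner (v : Plane) : Measurable (markInner v) :=
  ((measurable_summand 0).const_mul _).add ((measurable_summand 1).const_mul _)

theorem compoundSum_markInner (v : Plane) (b : Block) :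
    compoundSum (markInner v) b = v 0 * blockSum 0 b + v 1 * blockSum 1 b := by
  have h (k : Fin 2) : blockSum k b = compoundSum (summand k) b := rfl
  rw [h, h]
  simp only [compoundSum, markInner, Finset.sum_add_distrib, Finset.mul_sum]

/-- Regrouping the inner product with `u` by blocks gives three independent compound sums. The
shared block sees all of `u`, each of the others a single coordinate. -/
theorem charFun_logBP {d t : ℝ} (hd : 0 ≤ d) (ht0 : 0 ≤ t) (ht1 : t ≤ 1)
    (ρ : ProbabilityMeasure Plane) (u : Plane) :
    charFun (logBP d t ρ : Measure Plane) u =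
      Complex.exp ((t * d : ℝ) *
        (∫ a, Complex.exp (markInner u a * Complex.I) ∂(markMeasure ρ) - 1)) *
      (Complex.exp (((1 - t) * d : ℝ) *
        (∫ a, Complex.exp (markInner !₂[u 0, 0] a * Complex.I) ∂(markMeasure ρ) - 1)) *
      Complex.exp (((1 - t) * d : ℝ) *
        (∫ a, Complex.exp (markInner !₂[0, u 1] a * Complex.I) ∂(markMeasure ρ) - 1))) := by
  have h1 : 0 ≤ t * d := mul_nonneg ht0 hd
  have h2 : 0 ≤ (1 - t) * d := mul_nonneg (by linarith) hd
  have hpoint (ω : Block × Block × Block) :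
      Complex.exp ((inner ℝ (updateVector ω) u : ℝ) * Complex.I) =
        Complex.exp (compoundSum (markInner u) ω.1 * Complex.I) *
        (Complex.exp (compoundSum (markInner !₂[u 0, 0]) ω.2.1 * Complex.I) *
          Complex.exp (compoundSum (markInner !₂[0, u 1]) ω.2.2 * Complex.I)) := by
    rw [← Complex.exp_add, ← Complex.exp_add, ← add_mul, ← add_mul]
    congr 2
    simp only [compoundSum_markInner]
    norm_cast
    simp [updateVector, PiLp.inner_apply, Fin.sum_univ_two]
    ring
  rw [charFun_apply, logBP_eq, integral_map measurable_updateVector.aemeasurable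
    (by fun_prop)]
  simp only [hpoint]
  rw [← integral_exp_compoundSum h1 (measurable_markInner _),
    ← integral_exp_compoundSum h2 (measurable_markInner _),
    ← integral_exp_compoundSum h2 (measurable_markInner _), sourceMeasure,
    integral_prod_mul (fun b => Complex.exp (compoundSum (markInner u) b * Complex.I))
      (fun ω : Block × Block => Complex.exp (compoundSum (markInner !₂[u 0, 0]) ω.1 * Complex.I) *
          Complex.exp (compoundSum (markInner !₂[0, u 1]) ω.2 * Complex.I)),
    integral_prod_mul (fun b => Complex.exp (compoundSum (markInner !₂[u 0, 0]) b * Complex.I))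
      (fun b => Complex.exp (compoundSum (markInner !₂[0, u 1]) b * Complex.I))]

/-- Restricted to actual signs: for `|r| > 1` the argument of the logarithm can vanish. -/
theorem continuous_logTanh_coord (h : Fin 2) {r : ℝ} (hr : r = 1 ∨ r = -1) :
    Continuous fun x : Plane => logTanh (x h) r := by
  have hc : Continuous fun x : Plane => x h := (EuclideanSpace.proj (𝕜 := ℝ) h).continuous
  rcases hr with rfl | rfl
  · exact continuous_logTanh_one.comp hc
  · exact continuous_logTanh_neg_one.comp hc

/-- Integrating out the signs leaves an integral against `ρ` alone, to which weak convergence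
applies. -/
theorem integral_exp_markInner (v : Plane) (ρ : ProbabilityMeasure Plane) :
    ∫ a, Complex.exp (markInner v a * Complex.I) ∂(markMeasure ρ) =
      ∫ x, (∫ s, ∫ r, Complex.exp (markInner v (x, s, r) * Complex.I) ∂signMeasure ∂signMeasure)
        ∂(ρ : Measure Plane) := by
  have hm := measurable_markInner v
  have hint : Integrable (fun a => Complex.exp (markInner v a * Complex.I)) (markMeasure ρ) :=
    Integrable.of_bound (C := 1) (by fun_prop) (Eventually.of_forall fun b => by
      rw [Complex.norm_exp_ofReal_mul_I])
  rw [markMeasure] at hint ⊢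
  rw [integral_prod _ hint]
  refine integral_congr_ae (Eventually.of_forall fun x => ?_)
  simp only
  rw [integral_prod]
  have hx : Measurable fun y : ℝ × ℝ => markInner v (x, y) := hm.comp measurable_prodMk_left
  exact Integrable.of_bound (C := 1)
    ((Complex.measurable_ofReal.comp hx).mul_const _).cexp.aestronglyMeasurable
    (Eventually.of_forall fun b => by rw [Complex.norm_exp_ofReal_mul_I])

theorem tendsto_integral_exp_markInner {ρs : ℕ → ProbabilityMeasure Plane}
    {ρ : ProbabilityMeasure Plane} (h : Tendsto ρs atTop (𝓝 ρ)) (v : Plane) :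
    Tendsto (fun n => ∫ a, Complex.exp (markInner v a * Complex.I) ∂(markMeasure (ρs n))) atTop
      (𝓝 (∫ a, Complex.exp (markInner v a * Complex.I) ∂(markMeasure ρ))) := by
  simp only [integral_exp_markInner]
  have hbound (x : Plane) : ‖∫ s, ∫ r, Complex.exp (markInner v (x, s, r) * Complex.I)
      ∂signMeasure ∂signMeasure‖ ≤ 1 := by
    have hin (s : ℝ) : ‖∫ r, Complex.exp (markInner v (x, s, r) * Complex.I) ∂signMeasure‖ ≤ 1 :=
      (norm_integral_le_of_norm_le_const (C := 1) (Eventually.of_forall fun r => by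
        rw [Complex.norm_exp_ofReal_mul_I])).trans_eq (by simp)
    exact (norm_integral_le_of_norm_le_const (Eventually.of_forall hin)).trans_eq (by simp)
  have hcont : Continuous fun x : Plane => ∫ s, ∫ r, Complex.exp (markInner v (x, s, r) *
      Complex.I) ∂signMeasure ∂signMeasure := by
    have h1 (k : Fin 2) := continuous_logTanh_coord k (Or.inl rfl)
    have h2 (k : Fin 2) := continuous_logTanh_coord k (Or.inr rfl)
    simp only [integral_signMeasure, markInner, summand, signed]
    fun_prop
  exact (ProbabilityMeasure.tendsto_iff_forall_integral_rclike_tendsto ℂ).1 h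
    (BoundedContinuousFunction.ofNormedAddCommGroup _ hcont 1 hbound)

/-- The operator is weakly sequentially continuous. -/
theorem tendsto_logBP {d t : ℝ} (hd : 0 ≤ d) (ht0 : 0 ≤ t) (ht1 : t ≤ 1)
    {ρs : ℕ → ProbabilityMeasure Plane} {ρ : ProbabilityMeasure Plane}
    (h : Tendsto ρs atTop (𝓝 ρ)) :
    Tendsto (fun n => logBP d t (ρs n)) atTop (𝓝 (logBP d t ρ)) := by
  refine ProbabilityMeasure.tendsto_of_tendsto_charFun fun u => ?_
  simp only [charFun_logBP hd ht0 ht1]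
  have hexp (c : ℝ) (v : Plane) := (Complex.continuous_exp.tendsto _).comp
    (((tendsto_integral_exp_markInner h v).sub_const 1).const_mul (c : ℂ))
  exact (hexp _ _).mul ((hexp _ _).mul (hexp _ _))

/-! ### Iteration from the atom at the origin -/

theorem finiteSecondMoment_logBP {d t : ℝ} (hd : 0 ≤ d) (ht0 : 0 ≤ t) (ht1 : t ≤ 1)
    {ρ : ProbabilityMeasure Plane} (hρ : FiniteSecondMoment ρ) :
    FiniteSecondMoment (logBP d t ρ) :=
  (lintegral_logBP_le hd ht0 ht1 one_pos hρ).trans_lt (ENNReal.add_lt_top.2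
    ⟨ENNReal.mul_lt_top ENNReal.ofReal_lt_top hρ, ENNReal.ofReal_lt_top⟩)

theorem finiteSecondMoment_atomZero : FiniteSecondMoment atomZero := by
  simp [FiniteSecondMoment, atomZero]

theorem finiteSecondMoment_iterate {d t : ℝ} (hd : 0 ≤ d) (ht0 : 0 ≤ t) (ht1 : t ≤ 1) (l : ℕ) :
    FiniteSecondMoment ((logBP d t)^[l] atomZero) := by
  induction l with
  | zero => exact finiteSecondMoment_atomZero
  | succ l ih =>
    rw [Function.iterate_succ_apply']
    exact finiteSecondMoment_logBP hd ht0 ht1 ih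

theorem exists_lintegral_iterate_le {d t : ℝ} (hd0 : 0 < d) (hd2 : d < 2) (ht0 : 0 ≤ t)
    (ht1 : t ≤ 1) : ∃ C : ENNReal, C ≠ ⊤ ∧
      ∀ l : ℕ, ∫⁻ x, ‖x‖ₑ ^ 2 ∂((logBP d t)^[l] atomZero : Measure Plane) ≤ C := by
  -- This choice makes the slope of the affine bound `(2 + d) / 4`, midway between `d / 2` and `1`.
  set ε : ℝ := (2 - d) / (2 * d) with hε_def
  have hε : 0 < ε := div_pos (by linarith) (by linarith)
  have ha : d * ((1 + ε) / 2) = (2 + d) / 4 := by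
    rw [hε_def]
    field_simp
    ring
  set B : ℝ := d * (2 * ((1 + ε⁻¹) * Real.log 2 ^ 2)) with hB_def
  have hB : 0 ≤ B := by positivity
  have h2d : 0 < 2 - d := by linarith
  -- The fixed point of `x ↦ (2 + d) / 4 * x + B`, so the bound reproduces itself.
  refine ⟨ENNReal.ofReal (4 * B / (2 - d)), ENNReal.ofReal_ne_top, fun l => ?_⟩
  induction l with
  | zero =>
    change ∫⁻ x : Plane, ‖x‖ₑ ^ 2 ∂(Measure.dirac 0) ≤ _
    simp
  | succ l ih =>
    rw [Function.iterate_succ_apply']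
    refine (lintegral_logBP_le hd0.le ht0 ht1 hε
      (finiteSecondMoment_iterate hd0.le ht0 ht1 l)).trans ?_
    rw [ha, ← hB_def]
    refine (add_le_add_left (mul_le_mul_right ih _) _).trans_eq ?_
    rw [← ENNReal.ofReal_mul (by positivity), ← ENNReal.ofReal_add (by positivity) hB]
    congr 1
    field_simp
    ring

theorem wasserstein2_iterate_le {d t : ℝ} (hd : 0 < d) (ht0 : 0 ≤ t) (ht1 : t ≤ 1) (l : ℕ) :
    wasserstein2 ((logBP d t)^[l] atomZero) ((logBP d t)^[l + 1] atomZero) ≤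
      ENNReal.ofReal (Real.sqrt (d / 2)) ^ l * wasserstein2 atomZero (logBP d t atomZero) := by
  have hfin (l : ℕ) := finiteSecondMoment_iterate hd.le ht0 ht1 l
  have hsucc (l : ℕ) := Function.iterate_succ_apply' (logBP d t) l atomZero
  induction l with
  | zero => rw [hsucc, Function.iterate_zero_apply, pow_zero, one_mul]
  | succ l ih =>
    have h := wasserstein2_logBP_le hd ht0 ht1 (hfin l) (hfin (l + 1))
    rw [← hsucc, ← hsucc] at h
    refine h.trans ?_
    rw [pow_succ', mul_assoc]
    exact mul_le_mul_right ih _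

theorem cauchySeq_charFun_iterate {d t : ℝ} (hd0 : 0 < d) (hd2 : d < 2) (ht0 : 0 ≤ t)
    (ht1 : t ≤ 1) (u : Plane) :
    CauchySeq fun l : ℕ => charFun ((logBP d t)^[l] atomZero : Measure Plane) u := by
  set w : ENNReal := wasserstein2 atomZero (logBP d t atomZero) with hw_def
  have hw : w ≠ ⊤ := (wasserstein2_lt_top finiteSecondMoment_atomZero
    (finiteSecondMoment_logBP hd0.le ht0 ht1 finiteSecondMoment_atomZero)).ne
  refine cauchySeq_of_le_geometric (Real.sqrt (d / 2)) (‖u‖ * w.toReal) ?_ fun l => ?_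
  · rw [Real.sqrt_lt' one_pos]
    linarith
  · rw [dist_eq_norm, ← ENNReal.ofReal_le_ofReal_iff (by positivity), ofReal_norm]
    refine (enorm_charFun_sub_le _ _ u).trans ((mul_le_mul_right
      (wasserstein2_iterate_le hd0 ht0 ht1 l) _).trans_eq ?_)
    rw [ENNReal.ofReal_mul (by positivity), ENNReal.ofReal_mul (norm_nonneg _),
      ENNReal.ofReal_toReal hw, ofReal_norm, ENNReal.ofReal_pow (Real.sqrt_nonneg _)]
    ring

theorem eq_of_logBP_eq {d t : ℝ} (hd0 : 0 < d) (hd2 : d < 2) (ht0 : 0 ≤ t) (ht1 : t ≤ 1)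
    {ρ ν : ProbabilityMeasure Plane} (hρ : FiniteSecondMoment ρ) (hν : FiniteSecondMoment ν)
    (hρfix : logBP d t ρ = ρ) (hνfix : logBP d t ν = ν) : ρ = ν := by
  refine eq_of_wasserstein2_eq_zero ?_
  by_contra hne
  have h := wasserstein2_logBP_le hd0 ht0 ht1 hρ hν
  rw [hρfix, hνfix] at h
  have hlt : ENNReal.ofReal (Real.sqrt (d / 2)) < 1 := by
    rw [ENNReal.ofReal_lt_one, Real.sqrt_lt' one_pos]
    linarith
  -- Strictness requires the distance to be both nonzero and finite; the latter is where the second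
  -- moments enter.
  have := ENNReal.mul_lt_mul_left hne (wasserstein2_lt_top hρ hν).ne hlt
  rw [one_mul] at this
  exact (h.trans_lt this).false

end TwoSAT

end

theorem proposition2p6 (d t : ℝ) (hd0 : 0 < d) (hd2 : d < 2) (ht0 : 0 ≤ t) (ht1 : t ≤ 1) :
    (∃ ρ : ProbabilityMeasure TwoSAT.Plane,
      (TwoSAT.logBP d t ρ = ρ ∧ TwoSAT.FiniteSecondMoment ρ) ∧
      (∀ ν : ProbabilityMeasure TwoSAT.Plane,
        TwoSAT.logBP d t ν = ν → TwoSAT.FiniteSecondMoment ν → ν = ρ) ∧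
      Tendsto (fun l : ℕ => (TwoSAT.logBP d t)^[l] TwoSAT.atomZero) atTop (𝓝 ρ)) ∧
    (∀ ρ : ProbabilityMeasure TwoSAT.Plane, TwoSAT.FiniteSecondMoment ρ →
      TwoSAT.FiniteSecondMoment (TwoSAT.logBP d t ρ)) ∧
    (∀ ρ ν : ProbabilityMeasure TwoSAT.Plane,
      TwoSAT.FiniteSecondMoment ρ → TwoSAT.FiniteSecondMoment ν →
      TwoSAT.wasserstein2 (TwoSAT.logBP d t ρ) (TwoSAT.logBP d t ν) ≤
        ENNReal.ofReal (Real.sqrt (d / 2)) * TwoSAT.wasserstein2 ρ ν) := by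
  obtain ⟨C, hC, hbound⟩ := TwoSAT.exists_lintegral_iterate_le hd0 hd2 ht0 ht1
  obtain ⟨ρ, hlim⟩ := TwoSAT.exists_tendsto_of_cauchySeq_charFun hC hbound
    (TwoSAT.cauchySeq_charFun_iterate hd0 hd2 ht0 ht1)
  have hρ : TwoSAT.FiniteSecondMoment ρ :=
    (TwoSAT.lintegral_enorm_sq_le_of_tendsto hlim hbound).trans_lt hC.lt_top
  -- The shifted sequence of iterates converges both to the image of the limit and to the limit
  -- itself.
  have hfix : TwoSAT.logBP d t ρ = ρ := by
    have h := TwoSAT.tendsto_logBP hd0.le ht0 ht1 hlim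
    simp only [← Function.iterate_succ_apply' (TwoSAT.logBP d t)] at h
    exact tendsto_nhds_unique h (hlim.comp (tendsto_add_atTop_nat 1))
  exact ⟨⟨ρ, ⟨hfix, hρ⟩,
    fun ν hν hν2 => TwoSAT.eq_of_logBP_eq hd0 hd2 ht0 ht1 hν2 hρ hν hfix, hlim⟩,
    fun _ h => TwoSAT.finiteSecondMoment_logBP hd0.le ht0 ht1 h,
    fun _ _ h h' => TwoSAT.wasserstein2_logBP_le hd0 ht0 ht1 h h'⟩
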